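/- Max Cover with private elements: the public input is a universe $\mathcal U$ of $n\ge 1$ elements, sets $S_1,\dots,S_m\subseteq\mathcal U$, an integer $0\le k\le m$ and a real $\varepsilon>0$; the private input is a subset $R\subseteq\mathcal U$. The output is a set $J$ of exactly $k$ indices, with coverage $\mathrm{cov}_R(J)=|R\cap\bigcup_{j\in J}S_j|$, and $\mathrm{OPT}_R=\max_{|J|=k}\mathrm{cov}_R(J)$. Let $f=\max_{u\in\mathcal U}|\{i: u\in S_i\}|$ be the maximum element degree. A randomized algorithm is $\varepsilon$-node differentially private if, for every public input, every pair $R_1,R_2$ with $|R_1\triangle R_2|=1$ and every set $Y$ of outputs, the probability of an output in $Y$ on $R_1$ is at most $e^{\varepsilon}$ times that on $R_2$. A randomized algorithm whose private input is the set system itself (over a public universe) is $\varepsilon$-edge differentially private if the same inequality holds for every two set systems $(S_i)_{i\le m},(S_i')_{i\le m}$ which differ in exactly one index $i$, with $|S_i\triangle S_i'|=1$. **Corollary.** There is an absolute constant $c\in\mathbb N$ such that for every $\eta>0$ there is a constant $C>0$, depending only on $\eta$, for which the following hold. 1. There is an $\varepsilon$-node differentially private algorithm for Max Cover (for every $\varepsilon>0$)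 which, on every input, outputs with probability at least $1-1/n^2$ a set $J$ with $$\mathrm{cov}_R(J)\ \ge\ \Bigl(1-\frac1e-\eta\Bigr)\mathrm{OPT}_R-C\,(\log n)^c\,\frac{fk}{\varepsilon};$$ that is, it achieves a $(1-1/e-\eta,\tilde O(fk/\varepsilon))$-approximation with high probability. 2. There is an algorithm $\mathcal B$ for Max Cover with a privacy parameter, which is $\varepsilon$-edge differentially private when run with any parameter $\varepsilon>0$, such that for every $\varepsilon>0$ and every $\mathcal U,S_1,\dots,S_m,k$ as above with $f\ge1$, running $\mathcal B$ with parameter $\varepsilon/f$ on the restricted system $S_1\cap R,\dots,S_m\cap R$ is $\varepsilon$-node differentially private and, for every $R$, with probability at least $1-1/n^2$ outputs a set $J$ with $$\mathrm{cov}_R(J)\ \ge\ \Bigl(1-\frac1e-\eta\Bigr)\mathrm{OPT}_R-C\,(\log (n+m))^c\,\frac{fk}{\varepsilon}.$$ -/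

import Mathlib

/-- A set system `S₁, …, Sₘ` over the universe `Fin n` of `n` elements. -/
abbrev SetSystem (n m : ℕ) := Fin m → Finset (Fin n)

namespace SetSystem

/-- The maximum element degree `f`: the largest number of sets containing a common element. -/
def maxDegree {n m : ℕ} (S : SetSystem n m) : ℕ :=
  Finset.univ.sup fun u : Fin n => (Finset.univ.filter fun i : Fin m => u ∈ S i).card

/-- The number of elements covered by the sets with indices in `J`. -/
def coverage {n m : ℕ} (S : SetSystem n m) (J : Finset (Fin m)) : ℕ :=
  (J.biUnion S).card

/-- The Max Cover optimum: the largest coverage of `k` of the sets. -/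
def opt {n m : ℕ} (S : SetSystem n m) (k : ℕ) : ℕ :=
  (Finset.powersetCard k Finset.univ).sup S.coverage

/-- The restricted system `S₁ ∩ R, …, Sₘ ∩ R`. -/
def restrict {n m : ℕ} (S : SetSystem n m) (R : Finset (Fin n)) : SetSystem n m :=
  fun i => S i ∩ R

end SetSystem

/-- A feasible Max Cover output: (the indices of) exactly `k` of the `m` sets. -/
abbrev Solution (m k : ℕ) := {J : Finset (Fin m) // J.card = k}

/-- Two set systems over the same universe are edge-neighbors if they differ in exactly one set,
and that set differs by exactly one element. -/
def EdgeNeighbor {n m : ℕ} (S₁ S₂ : SetSystem n m) : Prop :=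
  ∃ i, (symmDiff (S₁ i) (S₂ i)).card = 1 ∧ ∀ j, j ≠ i → S₁ j = S₂ j

/-- Two private subsets of the universe are node-neighbors if they differ by exactly one element. -/
def NodeNeighbor {n : ℕ} (R₁ R₂ : Finset (Fin n)) : Prop :=
  (symmDiff R₁ R₂).card = 1

/-- Pure `ε`-differential privacy of a randomized mechanism `M` with respect to a neighboring
relation on its private inputs. -/
def IsDP {X Y : Type} (Neighbor : X → X → Prop) (ε : ℝ) (M : X → PMF Y) : Prop :=
  ∀ x₁ x₂ : X, Neighbor x₁ x₂ → ∀ E : Set Y,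
    (M x₁).toOuterMeasure E ≤ ENNReal.ofReal (Real.exp ε) * (M x₂).toOuterMeasure E

/-- A random choice `P` of `k` sets is an `(α, β)`-approximation for Max Cover on `S` with
probability at least `p`. -/
def IsApproxWithProb {n m k : ℕ} (S : SetSystem n m) (α β p : ℝ) (P : PMF (Solution m k)) :
    Prop :=
  p ≤ (P.toOuterMeasure
    {J : Solution m k | α * (S.opt k : ℝ) - β ≤ (S.coverage J.1 : ℝ)}).toReal

/-- A randomized Max Cover algorithm for the node model: for `k ≤ m` and a privacy parameter, it
takes the public set system and the private set `R` of elements to be covered. -/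
abbrev NodeAlgorithm :=
  ∀ n m k : ℕ, k ≤ m → ℝ → SetSystem n m → Finset (Fin n) → PMF (Solution m k)

/-- A randomized Max Cover algorithm for the edge model: for `k ≤ m` and a privacy parameter, it
takes the private set system. -/
abbrev EdgeAlgorithm :=
  ∀ n m k : ℕ, k ≤ m → ℝ → SetSystem n m → PMF (Solution m k)

/-!
Both algorithms are the exponential mechanism scored by coverage. Coverage has sensitivity one under
edge changes of the set system and also under node changes of `R`, so privacy costs nothing extra,
and with `N` candidate outputs, one of them optimal, the mechanism loses at most
`2 log (N n²) / ε` against the exact optimum with probability `1 - 1 / n²`.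

In the edge model all `N ≤ m ^ k` solutions are candidates. In the node model `m` may not appear in
the error, but the set system is public and has at most `n f` nonempty sets: choosing among these
only (padded by empty sets if there are fewer than `k`) leaves `N ≤ (n f) ^ k ≤ n ^ (f k)`
candidates, which contain an optimum for every `R` simultaneously.
-/

section ProbabilityMassFunctions

variable {Y : Type*}

theorem toOuterMeasure_add_toOuterMeasure_compl (P : PMF Y) (E : Set Y) :
    P.toOuterMeasure E + P.toOuterMeasure Eᶜ = 1 := by
  rw [PMF.toOuterMeasure_apply, PMF.toOuterMeasure_apply, ← ENNReal.tsum_add, ← P.tsum_coe]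
  exact tsum_congr fun y => congrFun (Set.indicator_self_add_compl E P) y

theorem toOuterMeasure_le_one (P : PMF Y) (E : Set Y) : P.toOuterMeasure E ≤ 1 :=
  le_self_add.trans_eq (toOuterMeasure_add_toOuterMeasure_compl P E)

theorem toReal_toOuterMeasure_mono {P : PMF Y} {p q : Y → Prop} (h : ∀ y, p y → q y) :
    (P.toOuterMeasure {y | p y}).toReal ≤ (P.toOuterMeasure {y | q y}).toReal :=
  ENNReal.toReal_mono (ne_top_of_le_ne_top ENNReal.one_ne_top (toOuterMeasure_le_one P _))
    (MeasureTheory.measure_mono h)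

theorem one_sub_le_toReal_toOuterMeasure {P : PMF Y} {E : Set Y} {δ : ℝ} (hδ : 0 ≤ δ)
    (h : P.toOuterMeasure Eᶜ ≤ ENNReal.ofReal δ) : 1 - δ ≤ (P.toOuterMeasure E).toReal := by
  have hE := ne_top_of_le_ne_top ENNReal.one_ne_top (toOuterMeasure_le_one P E)
  have hEc := ne_top_of_le_ne_top ENNReal.one_ne_top (toOuterMeasure_le_one P Eᶜ)
  have hsum : (P.toOuterMeasure E).toReal + (P.toOuterMeasure Eᶜ).toReal = 1 := by
    rw [← ENNReal.toReal_add hE hEc, toOuterMeasure_add_toOuterMeasure_compl, ENNReal.toReal_one]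
  linarith [ENNReal.toReal_le_of_le_ofReal hδ h]

theorem normalize_apply_le_sq_mul {f g : Y → ENNReal} {a : ENNReal} (hf₀ : ∑' y, f y ≠ 0)
    (hf : ∑' y, f y ≠ ⊤) (hg₀ : ∑' y, g y ≠ 0) (hg : ∑' y, g y ≠ ⊤) (hfg : ∀ y, f y ≤ a * g y)
    (hgf : ∀ y, g y ≤ a * f y) (y : Y) :
    PMF.normalize f hf₀ hf y ≤ a ^ 2 * PMF.normalize g hg₀ hg y := by
  have hsum : ∑' y, g y ≤ a * ∑' y, f y := by
    rw [← ENNReal.tsum_mul_left]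
    exact ENNReal.tsum_le_tsum hgf
  have hinv : (∑' y, f y)⁻¹ ≤ a * (∑' y, g y)⁻¹ := by
    rw [← div_eq_mul_inv, ENNReal.le_div_iff_mul_le (Or.inl hg₀) (Or.inl hg), mul_comm,
      ← div_eq_mul_inv]
    exact ENNReal.div_le_of_le_mul hsum
  rw [PMF.normalize_apply, PMF.normalize_apply]
  calc f y * (∑' y, f y)⁻¹ ≤ (a * g y) * (a * (∑' y, g y)⁻¹) := mul_le_mul' (hfg y) hinv
    _ = a ^ 2 * (g y * (∑' y, g y)⁻¹) := by ring

end ProbabilityMassFunctions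

namespace IsDP

variable {X Y : Type} {Neighbor : X → X → Prop} {ε ε' : ℝ} {M : X → PMF Y}

theorem of_apply_le
    (h : ∀ x₁ x₂, Neighbor x₁ x₂ → ∀ y, M x₁ y ≤ ENNReal.ofReal (Real.exp ε) * M x₂ y) :
    IsDP Neighbor ε M := by
  intro x₁ x₂ hx E
  rw [PMF.toOuterMeasure_apply, PMF.toOuterMeasure_apply, ← ENNReal.tsum_mul_left]
  refine ENNReal.tsum_le_tsum fun y => ?_
  by_cases hy : y ∈ E
  · simpa only [Set.indicator_of_mem hy] using h x₁ x₂ hx y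
  · simp only [Set.indicator_of_notMem hy, zero_le]

theorem mono (h : IsDP Neighbor ε M) (hε : ε ≤ ε') : IsDP Neighbor ε' M :=
  fun x₁ x₂ hx E => (h x₁ x₂ hx E).trans (by gcongr)

end IsDP

namespace IsApproxWithProb

variable {n m k : ℕ} {S : SetSystem n m} {α α' β β' p : ℝ} {P : PMF (Solution m k)}

theorem mono (h : IsApproxWithProb S α β p P) (hα : α' ≤ α) (hβ : β ≤ β') :
    IsApproxWithProb S α' β' p P := by
  refine h.trans (toReal_toOuterMeasure_mono fun J => le_trans ?_)
  gcongr

theorem of_prob_nonpos (hp : p ≤ 0) : IsApproxWithProb S α β p P :=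
  hp.trans ENNReal.toReal_nonneg

theorem of_opt_eq_zero (hS : S.opt k = 0) (hβ : 0 ≤ β) (hp : p ≤ 1) :
    IsApproxWithProb S α β p P := by
  have hall : P.toOuterMeasure {J | α * (S.opt k : ℝ) - β ≤ S.coverage J.1} = 1 := by
    refine (P.toOuterMeasure_apply_eq_one_iff _).2 fun J _ => ?_
    rw [Set.mem_ofPred_eq, hS, Nat.cast_zero, mul_zero, zero_sub]
    exact (neg_nonpos.2 hβ).trans (Nat.cast_nonneg _)
  rwa [IsApproxWithProb, hall, ENNReal.toReal_one]

end IsApproxWithProb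

section ExponentialMechanism

variable {Y : Type*} {ε : ℝ} {s : Finset Y} {q : Y → ℝ}

/-- The unnormalized probabilities `exp (ε q / 2)` of the exponential mechanism with score `q`, set
to zero outside the finite set `s` of candidates. -/
noncomputable def expWeight (ε : ℝ) (s : Finset Y) (q : Y → ℝ) : Y → ENNReal :=
  (s : Set Y).indicator fun y => ENNReal.ofReal (Real.exp (ε * q y / 2))

theorem expWeight_of_mem {y : Y} (hy : y ∈ s) :
    expWeight ε s q y = ENNReal.ofReal (Real.exp (ε * q y / 2)) :=
  Set.indicator_of_mem (Finset.mem_coe.2 hy) _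

theorem expWeight_of_notMem {y : Y} (hy : y ∉ s) : expWeight ε s q y = 0 :=
  Set.indicator_of_notMem (mt Finset.mem_coe.1 hy) _

theorem tsum_expWeight_ne_zero (hs : s.Nonempty) : ∑' y, expWeight ε s q y ≠ 0 := by
  obtain ⟨y, hy⟩ := hs
  have hpos : 0 < expWeight ε s q y := by
    rw [expWeight_of_mem hy]
    exact ENNReal.ofReal_pos.2 (Real.exp_pos _)
  exact (hpos.trans_le (ENNReal.le_tsum y)).ne'

theorem tsum_expWeight_ne_top : ∑' y, expWeight ε s q y ≠ ⊤ := by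
  rw [tsum_eq_sum fun _ => expWeight_of_notMem]
  refine ENNReal.sum_ne_top.2 fun y hy => ?_
  rw [expWeight_of_mem hy]
  exact ENNReal.ofReal_ne_top

theorem expWeight_le_mul {q₁ q₂ : Y → ℝ} {Δ : ℝ} (hε : 0 ≤ ε) {y : Y} (h : q₁ y - q₂ y ≤ Δ) :
    expWeight ε s q₁ y ≤ ENNReal.ofReal (Real.exp (ε * Δ / 2)) * expWeight ε s q₂ y := by
  by_cases hy : y ∈ s
  · rw [expWeight_of_mem hy, expWeight_of_mem hy, ← ENNReal.ofReal_mul (Real.exp_pos _).le,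
      ← Real.exp_add]
    gcongr
    linarith [mul_le_mul_of_nonneg_left h hε]
  · rw [expWeight_of_notMem hy]
    exact zero_le

/-- The exponential mechanism of McSherry and Talwar on the finite set `s` of candidates: `y ∈ s` is
chosen with probability proportional to `exp (ε q(y) / 2)`. -/
noncomputable def expMechanism (ε : ℝ) (s : Finset Y) (hs : s.Nonempty) (q : Y → ℝ) : PMF Y :=
  PMF.normalize (expWeight ε s q) (tsum_expWeight_ne_zero hs) tsum_expWeight_ne_top

theorem expMechanism_apply_of_notMem (hs : s.Nonempty) {y : Y} (hy : y ∉ s) :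
    expMechanism ε s hs q y = 0 := by
  rw [expMechanism, PMF.normalize_apply, expWeight_of_notMem hy, zero_mul]

theorem isDP_expMechanism {X Y : Type} {Neighbor : X → X → Prop} {s : Finset Y} {Δ : ℝ}
    (hε : 0 ≤ ε) (hs : s.Nonempty) {q : X → Y → ℝ}
    (hq : ∀ x₁ x₂, Neighbor x₁ x₂ → ∀ y, |q x₁ y - q x₂ y| ≤ Δ) :
    IsDP Neighbor (ε * Δ) fun x => expMechanism ε s hs (q x) := by
  refine IsDP.of_apply_le fun x₁ x₂ hx y => ?_
  have hsq : ENNReal.ofReal (Real.exp (ε * Δ / 2)) ^ 2 = ENNReal.ofReal (Real.exp (ε * Δ)) := by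
    rw [← ENNReal.ofReal_pow (Real.exp_pos _).le, ← Real.exp_nat_mul, Nat.cast_ofNat,
      mul_div_cancel₀ _ two_ne_zero]
  rw [← hsq]
  exact normalize_apply_le_sq_mul _ _ _ _
    (fun z => expWeight_le_mul hε (abs_le.1 (hq x₁ x₂ hx z)).2)
    (fun z => expWeight_le_mul hε (by linarith [(abs_le.1 (hq x₁ x₂ hx z)).1])) y

theorem expMechanism_apply_le (hs : s.Nonempty) {y y₀ : Y} (hy : y ∈ s) (hy₀ : y₀ ∈ s) :
    expMechanism ε s hs q y ≤ ENNReal.ofReal (Real.exp (ε * (q y - q y₀) / 2)) := by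
  rw [expMechanism, PMF.normalize_apply, ← div_eq_mul_inv]
  refine ENNReal.div_le_of_le_mul ?_
  calc expWeight ε s q y
      = ENNReal.ofReal (Real.exp (ε * (q y - q y₀) / 2)) * expWeight ε s q y₀ := by
        rw [expWeight_of_mem hy, expWeight_of_mem hy₀, ← ENNReal.ofReal_mul (Real.exp_pos _).le,
          ← Real.exp_add]
        ring_nf
    _ ≤ ENNReal.ofReal (Real.exp (ε * (q y - q y₀) / 2)) * ∑' z, expWeight ε s q z := by
        gcongr
        exact ENNReal.le_tsum y₀

theorem toOuterMeasure_expMechanism_le (hε : 0 ≤ ε) (hs : s.Nonempty) {y₀ : Y} (hy₀ : y₀ ∈ s)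
    (t : ℝ) :
    (expMechanism ε s hs q).toOuterMeasure {y | q y < q y₀ - t} ≤
      ENNReal.ofReal (s.card * Real.exp (-(ε * t / 2))) := by
  rw [PMF.toOuterMeasure_apply, tsum_eq_sum fun y hy =>
    Set.indicator_apply_eq_zero.2 fun _ => expMechanism_apply_of_notMem hs hy]
  calc ∑ y ∈ s, Set.indicator {y | q y < q y₀ - t} (expMechanism ε s hs q) y
      ≤ ∑ _y ∈ s, ENNReal.ofReal (Real.exp (-(ε * t / 2))) := by
        refine Finset.sum_le_sum fun y hy =>
          Set.indicator_apply_le' (fun hyt => ?_) fun _ => zero_le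
        refine (expMechanism_apply_le hs hy hy₀).trans ?_
        have hgap : q y - q y₀ ≤ -t := by linarith [Set.mem_ofPred_eq ▸ hyt]
        gcongr
        linarith [mul_le_mul_of_nonneg_left hgap hε]
    _ = ENNReal.ofReal (s.card * Real.exp (-(ε * t / 2))) := by
        rw [Finset.sum_const, nsmul_eq_mul, ENNReal.ofReal_mul (Nat.cast_nonneg _),
          ENNReal.ofReal_natCast]

theorem one_sub_le_toReal_toOuterMeasure_expMechanism (hε : 0 < ε) (hs : s.Nonempty) {y₀ : Y}
    (hy₀ : y₀ ∈ s) {δ : ℝ} (hδ : 0 < δ) :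
    1 - δ ≤ ((expMechanism ε s hs q).toOuterMeasure
      {y | q y₀ - 2 * Real.log (s.card / δ) / ε ≤ q y}).toReal := by
  have hcard : (0 : ℝ) < s.card := Nat.cast_pos.2 hs.card_pos
  have htail : s.card * Real.exp (-(ε * (2 * Real.log (s.card / δ) / ε) / 2)) = δ := by
    rw [mul_div_cancel₀ _ hε.ne', mul_div_cancel_left₀ _ two_ne_zero, Real.exp_neg,
      Real.exp_log (div_pos hcard hδ)]
    field_simp
  refine one_sub_le_toReal_toOuterMeasure hδ.le ?_
  have hbound := toOuterMeasure_expMechanism_le (q := q) hε.le hs hy₀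
    (2 * Real.log (s.card / δ) / ε)
  rw [htail] at hbound
  simpa only [Set.compl_ofPred, not_le] using hbound

end ExponentialMechanism

namespace SetSystem

variable {n m k : ℕ}

theorem coverage_le_add_card {S₁ S₂ : SetSystem n m} {D : Finset (Fin n)}
    (h : ∀ j, symmDiff (S₁ j) (S₂ j) ⊆ D) (J : Finset (Fin m)) :
    S₁.coverage J ≤ S₂.coverage J + D.card := by
  refine (Finset.card_le_card fun u hu => ?_).trans (Finset.card_union_le _ _)
  obtain ⟨j, hj, huj⟩ := Finset.mem_biUnion.1 hu
  by_cases hu₂ : u ∈ S₂ j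
  · exact Finset.mem_union_left _ (Finset.mem_biUnion.2 ⟨j, hj, hu₂⟩)
  · exact Finset.mem_union_right _ (h j (Finset.mem_symmDiff.2 (Or.inl ⟨huj, hu₂⟩)))

theorem abs_coverage_sub_coverage_le {S₁ S₂ : SetSystem n m} {D : Finset (Fin n)}
    (h : ∀ j, symmDiff (S₁ j) (S₂ j) ⊆ D) (J : Finset (Fin m)) :
    |(S₁.coverage J : ℝ) - S₂.coverage J| ≤ D.card := by
  rw [abs_sub_le_iff, sub_le_iff_le_add', sub_le_iff_le_add']
  exact_mod_cast And.intro (coverage_le_add_card h J)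
    (coverage_le_add_card (fun j => symmDiff_comm (S₁ j) (S₂ j) ▸ h j) J)

theorem abs_coverage_sub_le_of_edgeNeighbor {S₁ S₂ : SetSystem n m} (h : EdgeNeighbor S₁ S₂)
    (J : Finset (Fin m)) : |(S₁.coverage J : ℝ) - S₂.coverage J| ≤ 1 := by
  obtain ⟨i, hcard, hne⟩ := h
  refine (abs_coverage_sub_coverage_le (D := symmDiff (S₁ i) (S₂ i)) (fun j => ?_) J).trans_eq
    (by rw [hcard, Nat.cast_one])
  by_cases hj : j = i
  · rw [hj]
  · rw [hne j hj, symmDiff_self]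
    exact Finset.empty_subset _

theorem abs_coverage_restrict_sub_le_of_nodeNeighbor (S : SetSystem n m) {R₁ R₂ : Finset (Fin n)}
    (h : NodeNeighbor R₁ R₂) (J : Finset (Fin m)) :
    |((S.restrict R₁).coverage J : ℝ) - (S.restrict R₂).coverage J| ≤ 1 := by
  refine (abs_coverage_sub_coverage_le (D := symmDiff R₁ R₂) (fun j => ?_) J).trans_eq
    (by rw [h, Nat.cast_one])
  exact (inf_symmDiff_distrib_left (S j) R₁ R₂).symm.trans_le inf_le_right

theorem exists_coverage_eq_opt (hk : k ≤ m) (S : SetSystem n m) :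
    ∃ J : Solution m k, S.coverage J.1 = S.opt k := by
  have hne : (Finset.powersetCard k (Finset.univ : Finset (Fin m))).Nonempty :=
    Finset.powersetCard_nonempty.2 (by rwa [Finset.card_fin])
  obtain ⟨J, hJ, hopt⟩ := Finset.exists_mem_eq_sup _ hne S.coverage
  exact ⟨⟨J, (Finset.mem_powersetCard.1 hJ).2⟩, hopt.symm⟩

theorem opt_zero (S : SetSystem n m) : S.opt 0 = 0 := by
  simp [opt, coverage]

/-- The indices of the nonempty sets of a set system, the only ones that matter for coverage. -/
def support (S : SetSystem n m) : Finset (Fin m) :=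
  Finset.univ.filter fun i => (S i).Nonempty

theorem support_restrict_subset (S : SetSystem n m) (R : Finset (Fin n)) :
    (S.restrict R).support ⊆ S.support :=
  Finset.monotone_filter_right _ fun _ _ h => h.mono Finset.inter_subset_left

theorem card_support_le (S : SetSystem n m) : S.support.card ≤ n * S.maxDegree := by
  have hcount := Finset.card_mul_le_card_mul (s := S.support) (t := Finset.univ) (m := 1)
    (n := S.maxDegree) (fun i u => u ∈ S i) (fun i hi => ?_) fun u hu => ?_
  · simpa only [mul_one, Finset.card_fin] using hcount
  · obtain ⟨u, hu⟩ := (Finset.mem_filter.1 hi).2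
    exact Finset.card_pos.2 ⟨u, Finset.mem_filter.2 ⟨Finset.mem_univ u, hu⟩⟩
  · exact (Finset.card_le_card (Finset.filter_subset_filter _ (Finset.subset_univ _))).trans
      (Finset.le_sup (f := fun u => (Finset.univ.filter fun i => u ∈ S i).card) hu)

theorem coverage_le_of_inter_support_subset (S : SetSystem n m) {J J' : Finset (Fin m)}
    (h : J ∩ S.support ⊆ J') : S.coverage J ≤ S.coverage J' := by
  refine Finset.card_le_card fun u hu => ?_
  obtain ⟨j, hj, huj⟩ := Finset.mem_biUnion.1 hu
  have hjS : j ∈ S.support := Finset.mem_filter.2 ⟨Finset.mem_univ j, u, huj⟩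
  exact Finset.mem_biUnion.2 ⟨j, h (Finset.mem_inter.2 ⟨hj, hjS⟩), huj⟩

theorem opt_eq_zero_of_support_eq_empty {S : SetSystem n m} (hS : S.support = ∅) (k : ℕ) :
    S.opt k = 0 := by
  refine Nat.le_zero.1 (Finset.sup_le fun J _ => ?_)
  exact S.coverage_le_of_inter_support_subset (J' := ∅) (by rw [hS, Finset.inter_empty])

theorem opt_restrict_eq_zero_of_maxDegree_eq_zero {S : SetSystem n m} (hS : S.maxDegree = 0)
    (R : Finset (Fin n)) (k : ℕ) : (S.restrict R).opt k = 0 := by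
  have hcard : S.support.card = 0 := by simpa [hS] using S.card_support_le
  exact opt_eq_zero_of_support_eq_empty
    (Finset.subset_empty.1 (Finset.card_eq_zero.1 hcard ▸ S.support_restrict_subset R)) k

theorem exists_support_subset_card_eq (hk : k ≤ m) (S : SetSystem n m) :
    ∃ T : Finset (Fin m), S.support ⊆ T ∧ T.card = max k S.support.card :=
  Finset.exists_superset_card_eq (le_max_right _ _)
    (max_le (by rwa [Fintype.card_fin]) (Finset.card_le_univ _))

/-- The indices from which the candidate solutions are drawn: those of the nonempty sets, padded by
arbitrary further ones if there are fewer than `k`. It depends on the public set system only. -/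
noncomputable def candidatePool (hk : k ≤ m) (S : SetSystem n m) : Finset (Fin m) :=
  (S.exists_support_subset_card_eq hk).choose

theorem support_subset_candidatePool (hk : k ≤ m) (S : SetSystem n m) :
    S.support ⊆ S.candidatePool hk :=
  (S.exists_support_subset_card_eq hk).choose_spec.1

theorem card_candidatePool (hk : k ≤ m) (S : SetSystem n m) :
    (S.candidatePool hk).card = max k S.support.card :=
  (S.exists_support_subset_card_eq hk).choose_spec.2

/-- The candidate outputs of the node-private algorithm: the `k`-subsets of the candidate pool. -/
noncomputable def candidates (hk : k ≤ m) (S : SetSystem n m) : Finset (Solution m k) :=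
  (Finset.powersetCard k (S.candidatePool hk)).subtype fun J => J.card = k

theorem card_candidates_le (hk : k ≤ m) (S : SetSystem n m) (hn : n ≠ 0) (hn₁ : n ≠ 1) :
    (S.candidates hk).card ≤ n ^ (S.maxDegree * k) := by
  have hchoose : (S.candidates hk).card ≤ (max k S.support.card).choose k := by
    rw [candidates, Finset.card_subtype, ← S.card_candidatePool hk, ← Finset.card_powersetCard]
    exact Finset.card_filter_le _ _
  refine hchoose.trans ?_
  rcases le_total S.support.card k with hle | hle
  · rw [max_eq_left hle, Nat.choose_self]
    exact Nat.one_le_pow _ _ (Nat.pos_of_ne_zero hn)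
  · rw [max_eq_right hle]
    calc S.support.card.choose k ≤ S.support.card ^ k := Nat.choose_le_pow _ _
      _ ≤ (n ^ S.maxDegree) ^ k :=
        Nat.pow_le_pow_left (S.card_support_le.trans (Nat.mul_le_pow hn₁ _)) k
      _ = n ^ (S.maxDegree * k) := (pow_mul _ _ _).symm

theorem exists_mem_candidates_opt_le (hk : k ≤ m) {S S' : SetSystem n m}
    (h : S'.support ⊆ S.support) : ∃ J ∈ S.candidates hk, S'.opt k ≤ S'.coverage J.1 := by
  obtain ⟨J, hJ⟩ := S'.exists_coverage_eq_opt hk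
  obtain ⟨J', hJJ', hJ'pool, hJ'card⟩ := Finset.exists_subsuperset_card_eq
    (Finset.inter_subset_right.trans (h.trans (S.support_subset_candidatePool hk)))
    ((Finset.card_le_card Finset.inter_subset_left).trans_eq J.2)
    ((le_max_left _ _).trans_eq (S.card_candidatePool hk).symm)
  exact ⟨⟨J', hJ'card⟩, Finset.mem_subtype.2 (Finset.mem_powersetCard.2 ⟨hJ'pool, hJ'card⟩),
    hJ ▸ S'.coverage_le_of_inter_support_subset hJJ'⟩

theorem candidates_nonempty (hk : k ≤ m) (S : SetSystem n m) : (S.candidates hk).Nonempty :=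
  let ⟨J, hJ, _⟩ := exists_mem_candidates_opt_le hk (Finset.Subset.refl S.support)
  ⟨J, hJ⟩

end SetSystem

namespace Solution

theorem univ_nonempty {m k : ℕ} (hk : k ≤ m) : (Finset.univ : Finset (Solution m k)).Nonempty := by
  obtain ⟨J, -, hJ⟩ := Finset.exists_subset_card_eq (hk.trans_eq (Finset.card_fin m).symm)
  exact ⟨⟨J, hJ⟩, Finset.mem_univ _⟩

theorem card_univ_le (m k : ℕ) : (Finset.univ : Finset (Solution m k)).card ≤ m ^ k := by
  rw [Finset.card_univ, Fintype.card_finset_len, Fintype.card_fin]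
  exact Nat.choose_le_pow _ _

end Solution

section CoverageMechanism

variable {n m k : ℕ} {ε : ℝ} {s : Finset (Solution m k)}

/-- The exponential mechanism for Max Cover on the solutions in `s`, scored by their coverage. -/
noncomputable def coverageMechanism (ε : ℝ) (s : Finset (Solution m k)) (hs : s.Nonempty)
    (S : SetSystem n m) : PMF (Solution m k) :=
  expMechanism ε s hs fun J => (S.coverage J.1 : ℝ)

theorem isDP_edge_coverageMechanism (hε : 0 ≤ ε) (hs : s.Nonempty) :
    IsDP EdgeNeighbor ε (coverageMechanism (n := n) ε s hs) := by
  have h := isDP_expMechanism (Neighbor := EdgeNeighbor) hε hs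
    (q := fun (S : SetSystem n m) J => (S.coverage J.1 : ℝ))
    fun _ _ hS J => SetSystem.abs_coverage_sub_le_of_edgeNeighbor hS J.1
  rwa [mul_one] at h

theorem isDP_node_coverageMechanism_restrict (hε : 0 ≤ ε) (hs : s.Nonempty) (S : SetSystem n m) :
    IsDP NodeNeighbor ε fun R => coverageMechanism ε s hs (S.restrict R) := by
  have h := isDP_expMechanism (Neighbor := NodeNeighbor) hε hs
    (q := fun R J => ((S.restrict R).coverage J.1 : ℝ))
    fun _ _ hR J => S.abs_coverage_restrict_sub_le_of_nodeNeighbor hR J.1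
  rwa [mul_one] at h

theorem isApproxWithProb_coverageMechanism (hε : 0 < ε) (hs : s.Nonempty) {S : SetSystem n m}
    (hopt : ∃ J ∈ s, S.opt k ≤ S.coverage J.1) {δ : ℝ} (hδ : 0 < δ) :
    IsApproxWithProb S 1 (2 * Real.log (s.card / δ) / ε) (1 - δ) (coverageMechanism ε s hs S) := by
  obtain ⟨J₀, hJ₀, hle⟩ := hopt
  refine (one_sub_le_toReal_toOuterMeasure_expMechanism hε hs hJ₀ hδ).trans
    (toReal_toOuterMeasure_mono fun J => le_trans ?_)
  rw [one_mul]
  gcongr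

theorem isApproxWithProb_coverageMechanism_of_card_le_pow (hε : 0 < ε) (hs : s.Nonempty)
    {S : SetSystem n m} (hopt : ∃ J ∈ s, S.opt k ≤ S.coverage J.1) {b d : ℕ} (hn : 1 ≤ n)
    (hb : n ≤ b) (hd : 1 ≤ d) (hcard : s.card ≤ b ^ d) :
    IsApproxWithProb S 1 (6 * Real.log b * (d / ε)) (1 - 1 / (n : ℝ) ^ 2)
      (coverageMechanism ε s hs S) := by
  refine (isApproxWithProb_coverageMechanism hε hs hopt (by positivity)).mono le_rfl ?_
  have hcard_pos : (0 : ℝ) < s.card := Nat.cast_pos.2 hs.card_pos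
  have hpow : (s.card : ℝ) * (n : ℝ) ^ 2 ≤ (b : ℝ) ^ (d + 2) := by
    rw [pow_add]
    exact_mod_cast Nat.mul_le_mul hcard (Nat.pow_le_pow_left hb 2)
  have hlog : Real.log (s.card / (1 / (n : ℝ) ^ 2)) ≤ 3 * d * Real.log b := by
    rw [div_div_eq_mul_div, div_one]
    calc Real.log (s.card * (n : ℝ) ^ 2) ≤ Real.log ((b : ℝ) ^ (d + 2)) :=
        Real.log_le_log (mul_pos hcard_pos (by positivity)) hpow
      _ = (d + 2 : ℕ) * Real.log b := Real.log_pow _ _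
      _ ≤ (3 * d : ℕ) * Real.log b :=
        mul_le_mul_of_nonneg_right (Nat.cast_le.2 (by omega)) (Real.log_natCast_nonneg b)
      _ = 3 * d * Real.log b := by push_cast; rfl
  calc 2 * Real.log (s.card / (1 / (n : ℝ) ^ 2)) / ε ≤ 2 * (3 * d * Real.log b) / ε := by gcongr
    _ = 6 * Real.log b * (d / ε) := by ring

end CoverageMechanism

section Algorithms

variable {n m k : ℕ} {ε : ℝ}

/-- The node-private algorithm, which chooses among the candidates read off the public system. -/
noncomputable def nodeExpMechanism : NodeAlgorithm := fun _ _ _ hk ε S R =>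
  coverageMechanism ε (S.candidates hk) (S.candidates_nonempty hk) (S.restrict R)

/-- The edge-private algorithm, which chooses among all solutions since nothing about the set
system may be revealed. -/
noncomputable def edgeExpMechanism : EdgeAlgorithm := fun _ _ _ hk ε S =>
  coverageMechanism ε Finset.univ (Solution.univ_nonempty hk) S

theorem isApproxWithProb_nodeExpMechanism (hn : 1 ≤ n) (hk : k ≤ m) (hε : 0 < ε)
    (S : SetSystem n m) (R : Finset (Fin n)) :
    IsApproxWithProb (S.restrict R) 1 (6 * Real.log n * (S.maxDegree * k / ε))
      (1 - 1 / (n : ℝ) ^ 2) (nodeExpMechanism n m k hk ε S R) := by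
  have herror : 0 ≤ 6 * Real.log n * (S.maxDegree * k / ε) := by
    have := Real.log_natCast_nonneg n
    positivity
  have hprob : 1 - 1 / (n : ℝ) ^ 2 ≤ 1 := sub_le_self _ (by positivity)
  rcases eq_or_ne n 1 with rfl | hn₁
  · exact .of_prob_nonpos (by simp)
  rcases k.eq_zero_or_pos with rfl | hk₀
  · exact .of_opt_eq_zero (SetSystem.opt_zero _) herror hprob
  rcases S.maxDegree.eq_zero_or_pos with hf | hf
  · exact .of_opt_eq_zero (SetSystem.opt_restrict_eq_zero_of_maxDegree_eq_zero hf R k) herror hprob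
  exact_mod_cast isApproxWithProb_coverageMechanism_of_card_le_pow hε (S.candidates_nonempty hk)
    (SetSystem.exists_mem_candidates_opt_le hk (S.support_restrict_subset R)) hn le_rfl
    (Nat.mul_pos hf hk₀) (S.card_candidates_le hk (Nat.one_le_iff_ne_zero.1 hn) hn₁)

theorem isApproxWithProb_edgeExpMechanism (hn : 1 ≤ n) (hk : k ≤ m) (hε : 0 < ε)
    (S : SetSystem n m) :
    IsApproxWithProb S 1 (6 * Real.log (n + m) * (k / ε)) (1 - 1 / (n : ℝ) ^ 2)
      (edgeExpMechanism n m k hk ε S) := by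
  rcases k.eq_zero_or_pos with rfl | hk₀
  · exact .of_opt_eq_zero S.opt_zero (by simp) (sub_le_self _ (by positivity))
  obtain ⟨J, hJ⟩ := S.exists_coverage_eq_opt hk
  exact_mod_cast isApproxWithProb_coverageMechanism_of_card_le_pow hε (Solution.univ_nonempty hk)
    ⟨J, Finset.mem_univ J, hJ.ge⟩ hn (Nat.le_add_right n m) hk₀
    ((Solution.card_univ_le m k).trans (Nat.pow_le_pow_left (Nat.le_add_left m n) k))

end Algorithms

theorem mainTheorem4_general :
    ∃ C : ℝ, 0 < C ∧ ∀ α : ℝ, α ≤ 1 →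
      (∃ A : NodeAlgorithm,
        ∀ (n m k : ℕ) (_ : 1 ≤ n) (hk : k ≤ m) (ε : ℝ) (_ : 0 < ε) (S : SetSystem n m),
          IsDP NodeNeighbor ε (A n m k hk ε S) ∧
          ∀ R : Finset (Fin n),
            IsApproxWithProb (S.restrict R) α
              (C * Real.log (n : ℝ) * ((S.maxDegree : ℝ) * (k : ℝ) / ε))
              (1 - 1 / (n : ℝ) ^ 2) (A n m k hk ε S R)) ∧
      (∃ B : EdgeAlgorithm,
        (∀ (n m k : ℕ) (hk : k ≤ m) (ε : ℝ), 0 < ε → IsDP EdgeNeighbor ε (B n m k hk ε)) ∧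
        ∀ (n m k : ℕ) (_ : 1 ≤ n) (hk : k ≤ m) (ε : ℝ) (_ : 0 < ε) (S : SetSystem n m),
          0 < S.maxDegree →
          IsDP NodeNeighbor ε
            (fun R => B n m k hk (ε / (S.maxDegree : ℝ)) (S.restrict R)) ∧
          ∀ R : Finset (Fin n),
            IsApproxWithProb (S.restrict R) α
              (C * Real.log ((n : ℝ) + (m : ℝ)) * ((S.maxDegree : ℝ) * (k : ℝ) / ε))
              (1 - 1 / (n : ℝ) ^ 2)
              (B n m k hk (ε / (S.maxDegree : ℝ)) (S.restrict R))) := by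
  refine ⟨6, by norm_num, fun α hα => ⟨⟨nodeExpMechanism, fun n m k hn hk ε hε S => ⟨?_, ?_⟩⟩,
    edgeExpMechanism, ?_, fun n m k hn hk ε hε S hf => ?_⟩⟩
  · exact isDP_node_coverageMechanism_restrict hε.le (S.candidates_nonempty hk) S
  · exact fun R => (isApproxWithProb_nodeExpMechanism hn hk hε S R).mono hα le_rfl
  · exact fun n m k hk ε hε => isDP_edge_coverageMechanism hε.le (Solution.univ_nonempty hk)
  · have hf' : (1 : ℝ) ≤ S.maxDegree := Nat.one_le_cast.2 hf
    have hε' : 0 < ε / S.maxDegree := by positivity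
    refine ⟨(isDP_node_coverageMechanism_restrict hε'.le (Solution.univ_nonempty hk) S).mono
      (div_le_self hε.le hf'), fun R => ?_⟩
    refine (isApproxWithProb_edgeExpMechanism hn hk hε' (S.restrict R)).mono hα (le_of_eq ?_)
    rw [div_div_eq_mul_div, mul_comm (k : ℝ)]

theorem mainTheorem4 :
    ∃ c : ℕ, ∀ η : ℝ, 0 < η → ∃ C : ℝ, 0 < C ∧
      (∃ A : NodeAlgorithm,
        ∀ (n m k : ℕ) (_ : 1 ≤ n) (hk : k ≤ m) (ε : ℝ) (_ : 0 < ε) (S : SetSystem n m),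
          IsDP NodeNeighbor ε (A n m k hk ε S) ∧
          ∀ R : Finset (Fin n),
            IsApproxWithProb (S.restrict R) (1 - 1 / Real.exp 1 - η)
              (C * Real.log (n : ℝ) ^ c * ((S.maxDegree : ℝ) * (k : ℝ) / ε))
              (1 - 1 / (n : ℝ) ^ 2) (A n m k hk ε S R)) ∧
      (∃ B : EdgeAlgorithm,
        (∀ (n m k : ℕ) (hk : k ≤ m) (ε : ℝ), 0 < ε → IsDP EdgeNeighbor ε (B n m k hk ε)) ∧
        ∀ (n m k : ℕ) (_ : 1 ≤ n) (hk : k ≤ m) (ε : ℝ) (_ : 0 < ε) (S : SetSystem n m),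
          0 < S.maxDegree →
          IsDP NodeNeighbor ε
            (fun R => B n m k hk (ε / (S.maxDegree : ℝ)) (S.restrict R)) ∧
          ∀ R : Finset (Fin n),
            IsApproxWithProb (S.restrict R) (1 - 1 / Real.exp 1 - η)
              (C * Real.log ((n : ℝ) + (m : ℝ)) ^ c *
                ((S.maxDegree : ℝ) * (k : ℝ) / ε))
              (1 - 1 / (n : ℝ) ^ 2)
              (B n m k hk (ε / (S.maxDegree : ℝ)) (S.restrict R))) := by
  obtain ⟨C, hC, h⟩ := mainTheorem4_general
  refine ⟨1, fun η hη => ⟨C, hC, ?_⟩⟩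
  simpa only [pow_one] using h _ (by linarith [one_div_pos.2 (Real.exp_pos 1)])
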